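/- Let $B_n$ denote the $n$-dimensional Boolean lattice, i.e. the set of all subsets of $[n]=\{1,\dots,n\}$ ordered by inclusion. For a family $\mathcal F\subseteq B_n$, let the Lubell mass $\ell(\mathcal F)$ be the expected number of members of $\mathcal F$ on a uniformly random maximal chain of $B_n$; equivalently, $\ell(\mathcal F)=\sum_{A\in\mathcal F} 1/\binom{n}{|A|}$. For a poset $P$, call $\mathcal F$ $P$-free if $\mathcal F$, ordered by inclusion, contains no induced copy of $P$ (no injection $f:P\to\mathcal F$ with $x\le y \iff f(x)\subseteq f(y)$). Define the strong Lubell threshold $$\Lambda^*(P)=\sup\{\ell(\mathcal F) : n\ge 0,\ \mathcal F\subseteq B_n,\ \mathcal F \text{ is } P\text{-free}\}.$$ Then $\Lambda^*(B_3)\le 16$. That is, for every $n$, every family $\mathcal F$ of subsets of $[n]$ with $\ell(\mathcal F)>16$ contains an induced copy of the $3$-dimensional Boolean lattice $B_3$. -/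

import Mathlib

open scoped BigOperators

/-- The family `F` of sets is `P`-free: the inclusion order on `F` has no induced copy of `P`,
i.e. there is no map `P → F` that preserves and reflects the order. -/
def PosetFree (P : Type*) [PartialOrder P] {n : ℕ} (F : Finset (Finset (Fin n))) : Prop :=
  IsEmpty (P ↪o F)

/-- There are finitely many maximal chains in the Boolean lattice of subsets of an `n`-set. -/
noncomputable instance flagFintype (n : ℕ) : Fintype (Flag (Finset (Fin n))) :=
  Fintype.ofInjective (fun c => (c : Set (Finset (Fin n)))) SetLike.coe_injective

open Classical in
/-- The Lubell function `ℓ(F)`: the expected number of members of `F` on a uniformly random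
maximal chain (Mathlib's `Flag`) of the Boolean lattice of subsets of an `n`-set. -/
noncomputable def lubell {n : ℕ} (F : Finset (Finset (Fin n))) : ℝ :=
  𝔼 c : Flag (Finset (Fin n)), ((F.filter (fun A => A ∈ c)).card : ℝ)

/-- A maximal chain has exactly one set of each size. -/
theorem flag_existsUnique_card {n : ℕ} (c : Flag (Finset (Fin n))) (k : ℕ) (hk : k ≤ n) :
    ∃! A, A ∈ c ∧ A.card = k := by
  classical
  have huniq : ∀ A B, A ∈ c → B ∈ c → A.card = B.card → A = B := by
    intro A B hA hB h
    rcases c.le_or_le hA hB with h1 | h1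
    · exact Finset.eq_of_subset_of_card_le h1 h.ge
    · exact (Finset.eq_of_subset_of_card_le h1 h.le).symm
  suffices ∃ A, A ∈ c ∧ A.card = k by
    obtain ⟨A, hA, hA'⟩ := this
    exact ⟨A, ⟨hA, hA'⟩, fun B hB => huniq _ _ hB.1 hA (by rw [hB.2, hA'])⟩
  obtain ⟨B, hB, hBm⟩ := Finset.exists_max_image
    (Finset.univ.filter fun A => A ∈ c ∧ A.card ≤ k) Finset.card ⟨⊥, by have := c.bot_mem; simpa using this⟩
  obtain ⟨C, hC, hCm⟩ := Finset.exists_min_image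
    (Finset.univ.filter fun A => A ∈ c ∧ k ≤ A.card) Finset.card ⟨⊤, by have := c.top_mem; simpa [hk] using this⟩
  simp only [Finset.mem_filter, Finset.mem_univ, true_and] at hB hBm hC hCm
  have hsub : ∀ A B, A ∈ c → B ∈ c → A.card ≤ B.card → A ⊆ B := by
    intro A B hA hB h
    rcases c.le_or_le hA hB with h1 | h1
    · exact h1
    · exact (Finset.eq_of_subset_of_card_le h1 h).ge
  obtain ⟨D, h1, h2, h3⟩ := Finset.exists_subsuperset_card_eq
    (hsub B C hB.1 hC.1 (hB.2.trans hC.2)) hB.2 hC.2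
  refine ⟨D, c.mem_iff_forall_le_or_ge.2 fun E hE => ?_, h3⟩
  rcases le_total E.card k with h | h
  · exact Or.inr ((hsub E B hE hB.1 (hBm E ⟨hE, h⟩)).trans h1)
  · exact Or.inl (h2.trans (hsub C E hC.1 hE (hCm E ⟨hE, h⟩)))

open Classical in
/-- Agreement with the usual formula for the Lubell function. -/
theorem lubell_eq_sum {n : ℕ} (F : Finset (Finset (Fin n))) :
    lubell F = ∑ A ∈ F, (1 : ℝ) / (n.choose A.card) := by
  have hinv : ∀ (A B : Finset (Fin n)), A.card = B.card →
      (Finset.univ.filter fun c : Flag (Finset (Fin n)) => A ∈ c).card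
      = (Finset.univ.filter fun c : Flag (Finset (Fin n)) => B ∈ c).card := by
    intro A B h
    obtain ⟨σ, hσ⟩ : ∃ σ : Equiv.Perm (Fin n), A.map σ.toEmbedding = B := by
      let e : {x // x ∈ A} ≃ {x // x ∈ B} := Finset.equivOfCardEq h
      refine ⟨e.extendSubtype, ?_⟩
      apply Finset.eq_of_subset_of_card_le
      · intro x hx
        obtain ⟨y, hy, rfl⟩ := Finset.mem_map.1 hx
        exact Equiv.extendSubtype_mem e y hy
      · simp [h]
    let τ : Finset (Fin n) ≃o Finset (Fin n) :=
      { σ.finsetCongr with map_rel_iff' := by intro a b; simp }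
    refine Finset.card_equiv (Flag.map τ) fun c => ?_
    simp only [Finset.mem_filter, Finset.mem_univ, true_and]
    have : B = τ A := hσ.symm
    rw [this]
    change A ∈ c ↔ τ A ∈ τ '' (c : Set _)
    simp
  have : Nonempty (Flag (Finset (Fin n))) := inferInstance
  have hN : (Fintype.card (Flag (Finset (Fin n))) : ℝ) ≠ 0 := by
    simp [Fintype.card_ne_zero]
  have hcount : ∀ A : Finset (Fin n), n.choose A.card *
      (Finset.univ.filter fun c : Flag (Finset (Fin n)) => A ∈ c).card
      = Fintype.card (Flag (Finset (Fin n))) := by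
    intro A
    have h1 := Finset.sum_card_bipartiteAbove_eq_sum_card_bipartiteBelow
      (s := Finset.powersetCard A.card (Finset.univ : Finset (Fin n)))
      (t := (Finset.univ : Finset (Flag (Finset (Fin n))))) (fun B c => B ∈ c)
    unfold Finset.bipartiteAbove Finset.bipartiteBelow at h1
    rw [Finset.sum_congr rfl (fun B hB => hinv B A (Finset.mem_powersetCard.1 hB).2)] at h1
    have h2 : ∀ c ∈ (Finset.univ : Finset (Flag (Finset (Fin n)))),
        ((Finset.powersetCard A.card (Finset.univ : Finset (Fin n))).filter
          fun B => B ∈ c).card = 1 := by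
      intro c _
      rw [Finset.card_eq_one]
      obtain ⟨B, hB, hB'⟩ := flag_existsUnique_card c A.card (by simpa using A.card_le_univ)
      refine ⟨B, Finset.ext fun D => ?_⟩
      simp only [Finset.mem_filter, Finset.mem_powersetCard, Finset.subset_univ, true_and,
        Finset.mem_singleton]
      exact ⟨fun h => hB' D ⟨h.2, h.1⟩, fun h => h ▸ ⟨hB.2, hB.1⟩⟩
    rw [Finset.sum_congr rfl h2] at h1
    simpa using h1
  have hd := Finset.sum_card_bipartiteAbove_eq_sum_card_bipartiteBelow
      (s := F) (t := (Finset.univ : Finset (Flag (Finset (Fin n))))) (fun B c => B ∈ c)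
  unfold Finset.bipartiteAbove Finset.bipartiteBelow at hd
  rw [lubell, Fintype.expect_eq_sum_div_card, ← Nat.cast_sum, ← hd, Nat.cast_sum, Finset.sum_div]
  refine Finset.sum_congr rfl fun A _ => ?_
  have hc : (n.choose A.card : ℝ) ≠ 0 := by
    exact_mod_cast (Nat.choose_pos (by simpa using A.card_le_univ)).ne'
  rw [div_eq_div_iff hN hc, ← hcount A]
  push_cast; ring

/-- The strong Lubell threshold `Λ*(P)`: the supremum of `ℓ(F)` over all `n` and all `P`-free
families `F` of subsets of an `n`-set, as an extended real (so it is `⊤` if unbounded). -/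
noncomputable def strongLubellThreshold (P : Type*) [PartialOrder P] : EReal :=
  ⨆ (n : ℕ) (F : Finset (Finset (Fin n))) (_ : PosetFree P F), ((lubell F : ℝ) : EReal)

/-- The `n`-dimensional Boolean lattice: subsets of an `n`-set ordered by inclusion. -/
abbrev BooleanLattice (n : ℕ) : Type := Finset (Fin n)

/-! Read a random maximal chain from the top down. From its first member B onwards, the expected
number of members met is the mass of the family below B. A bound that holds at every member
therefore holds at every set (`lubellBelow_le_of_forall_mem`). Using this on the family and on its
complements, one may assume that ∅ and the ground set T are members.

Call x ∈ B a pivot of B if some member C contains B \ {x} but not x. Suppose three pivots x_i have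
members A_i ⊆ B whose traces on the triple are the singletons {x_i}. Then ∅, the A_i, the witnesses
C_i and T form an induced cube. In a cube-free family, the traces on the pivots of the members below
B thus shatter no triple, and Sauer–Shelah bounds their mass by 5. Comparing Beta weights gives
mass(B) · (#pivots + 1) ≤ 5(|B| + 1) (`lubellBelow_le_of_pivots`), so a member seeing mass above 10
has more than half of its elements as nonpivots.

Members seeing mass at most 10 contribute at most 10. The others contribute at most 2 in the lower
half, by counting in each layer (`lubellBelow_le_two`), and at most 4 in the upper half, since a
random chain misses them with probability at least 1/4 (`lubellBelow_le_four`). The sum is 16. -/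

/-! ### Lubell mass below a set, by conditioning on the top step of a chain. -/

section LubellBelow

variable {V : Type*} [DecidableEq V]

/-- The Lubell mass of the members of `F` below `X`, computed in the Boolean lattice of subsets
of `X`. -/
noncomputable def lubellBelow (F : Finset (Finset V)) (X : Finset V) : ℝ :=
  ∑ A ∈ F with A ⊆ X, (1 : ℝ) / (X.card.choose A.card)

theorem lubellBelow_nonneg (F : Finset (Finset V)) (X : Finset V) : 0 ≤ lubellBelow F X :=
  Finset.sum_nonneg fun _ _ => by positivity

theorem lubellBelow_mono {F G : Finset (Finset V)} (h : F ⊆ G) (X : Finset V) :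
    lubellBelow F X ≤ lubellBelow G X :=
  Finset.sum_le_sum_of_subset_of_nonneg (Finset.filter_subset_filter _ h)
    fun _ _ _ => by positivity

theorem lubellBelow_union_le (F G : Finset (Finset V)) (X : Finset V) :
    lubellBelow (F ∪ G) X ≤ lubellBelow F X + lubellBelow G X := by
  unfold lubellBelow
  rw [Finset.filter_union, ← Finset.sum_union_inter]
  exact le_add_of_nonneg_right (Finset.sum_nonneg fun _ _ => by positivity)

theorem lubellBelow_of_mem {F : Finset (Finset V)} {X : Finset V} (h : X ∈ F) :
    lubellBelow F X = 1 + lubellBelow (F.erase X) X := by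
  unfold lubellBelow
  rw [← Finset.add_sum_erase _ _ (show X ∈ F.filter (· ⊆ X) by simp [h]), Finset.filter_erase]
  simp

/-- A random maximal chain below X first drops a uniformly random element of X; if X is not a
member, this step loses nothing. -/
theorem lubellBelow_of_notMem {F : Finset (Finset V)} {X : Finset V} (h : X ∉ F) :
    lubellBelow F X = (∑ x ∈ X, lubellBelow F (X.erase x)) / X.card := by
  unfold lubellBelow
  have hswap : ∑ x ∈ X, ∑ A ∈ F with A ⊆ X.erase x, (1 : ℝ) / ((X.erase x).card.choose A.card)
      = ∑ A ∈ F with A ⊆ X, ∑ x ∈ X \ A, (1 : ℝ) / ((X.card - 1).choose A.card) := by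
    rw [Finset.sum_comm' (t' := F.filter (· ⊆ X)) (s' := fun A => X \ A)]
    · refine Finset.sum_congr rfl fun A _ => Finset.sum_congr rfl fun x hx => ?_
      rw [Finset.card_erase_of_mem (Finset.mem_sdiff.1 hx).1]
    · intro x A
      simp only [Finset.mem_filter, Finset.mem_sdiff, Finset.subset_erase]
      tauto
  rw [hswap, Finset.sum_div]
  refine Finset.sum_congr rfl fun A hA => ?_
  obtain ⟨hAF, hAX⟩ := Finset.mem_filter.1 hA
  have hlt : A.card < X.card :=
    Finset.card_lt_card (hAX.ssubset_of_ne (fun e => h (e ▸ hAF)))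
  rw [Finset.sum_const, Finset.card_sdiff_of_subset hAX, nsmul_eq_mul, Nat.cast_sub hlt.le]
  obtain ⟨m, hm⟩ : ∃ m, X.card = m + 1 := ⟨X.card - 1, by omega⟩
  rw [hm] at hlt ⊢
  have h1 : ((m + 1).choose A.card : ℝ) ≠ 0 := by
    exact_mod_cast (Nat.choose_pos hlt.le).ne'
  have h2 : (m.choose A.card : ℝ) ≠ 0 := by
    exact_mod_cast (Nat.choose_pos (Nat.lt_succ_iff.1 hlt)).ne'
  have key := Nat.choose_mul_succ_eq m A.card
  have key' : (m.choose A.card : ℝ) * (m + 1)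
      = (m + 1).choose A.card * ((m + 1 : ℕ) - (A.card : ℝ)) := by
    rw [← Nat.cast_sub hlt.le]; exact_mod_cast key
  rw [Nat.add_sub_cancel, mul_one_div, div_div, div_eq_div_iff h1 (by positivity)]
  push_cast at key' ⊢
  linarith

/-- If every member of `F` sees Lubell mass at most `c` below itself, so does every set. -/
theorem lubellBelow_le_of_forall_mem {F : Finset (Finset V)} {c : ℝ} (hc : 0 ≤ c)
    (h : ∀ B ∈ F, lubellBelow F B ≤ c) (X : Finset V) : lubellBelow F X ≤ c := by
  induction X using Finset.strongInduction with
  | H X ih =>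
    by_cases hX : X ∈ F
    · exact h X hX
    rw [lubellBelow_of_notMem hX]
    refine div_le_of_le_mul₀ (by positivity) hc ?_
    calc ∑ x ∈ X, lubellBelow F (X.erase x) ≤ ∑ _x ∈ X, c :=
          Finset.sum_le_sum fun x hx => ih _ (Finset.erase_ssubset hx)
      _ = c * X.card := by rw [Finset.sum_const, nsmul_eq_mul, mul_comm]

/-! ### Hitting probabilities and random orderings. -/

/-- The probability that a random maximal chain of subsets of `X` meets `H`. -/
noncomputable def hitProb (H : Finset (Finset V)) (X : Finset V) : ℝ :=
  if X ∈ H then 1 else (∑ x ∈ X.attach, hitProb H (X.erase x)) / X.card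
termination_by X.card
decreasing_by exact Finset.card_erase_lt_of_mem x.2

theorem hitProb_of_mem {H : Finset (Finset V)} {X : Finset V} (h : X ∈ H) :
    hitProb H X = 1 := by
  rw [hitProb, if_pos h]

theorem hitProb_of_notMem {H : Finset (Finset V)} {X : Finset V} (h : X ∉ H) :
    hitProb H X = (∑ x ∈ X, hitProb H (X.erase x)) / X.card := by
  rw [hitProb, if_neg h, Finset.sum_attach X fun x => hitProb H (X.erase x)]

/-- Condition on the first member of `H` met from the top: it exists with probability `hitProb`, and
from there on at most c members are expected. -/
theorem lubellBelow_le_mul_hitProb {H : Finset (Finset V)} {c : ℝ}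
    (h : ∀ B ∈ H, lubellBelow H B ≤ c) (X : Finset V) :
    lubellBelow H X ≤ c * hitProb H X := by
  induction X using Finset.strongInduction with
  | H X ih =>
    by_cases hX : X ∈ H
    · rw [hitProb_of_mem hX, mul_one]
      exact h X hX
    rw [lubellBelow_of_notMem hX, hitProb_of_notMem hX, mul_div_assoc', Finset.mul_sum]
    gcongr with x hx
    exact ih _ (Finset.erase_ssubset hx)

/-- The set of values of `q` at the indices at least `k`. -/
def suffix {m : ℕ} (q : Fin m → V) (k : ℕ) : Finset V :=
  (Finset.univ.filter fun i : Fin m => k ≤ i).image q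

theorem mem_suffix {m : ℕ} {q : Fin m → V} {k : ℕ} {x : V} :
    x ∈ suffix q k ↔ ∃ i : Fin m, k ≤ i ∧ q i = x := by
  simp [suffix]

/-- The chain of suffixes of the sequence `q` meets `H`. -/
def Hits {m : ℕ} (H : Finset (Finset V)) (q : Fin m → V) : Prop :=
  ∃ k, suffix q k ∈ H

theorem suffix_zero {m : ℕ} (q : Fin m → V) : suffix q 0 = Finset.univ.image q := by
  simp [suffix]

theorem suffix_succ {m : ℕ} (q : Fin (m + 1) → V) (k : ℕ) :
    suffix q (k + 1) = suffix (q ∘ Fin.succ) k := by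
  ext x
  simp only [mem_suffix, Function.comp]
  constructor
  · rintro ⟨i, hi, rfl⟩
    obtain ⟨j, rfl⟩ : ∃ j : Fin m, i = j.succ := by
      refine Fin.exists_succ_eq.2 ?_ |>.imp fun _ => Eq.symm
      rintro rfl
      simp at hi
    exact ⟨j, by simpa using hi, rfl⟩
  · rintro ⟨i, hi, rfl⟩
    exact ⟨i.succ, by simpa using hi, rfl⟩

theorem hits_of_notMem {m : ℕ} {H : Finset (Finset V)} {q : Fin (m + 1) → V}
    (h : Finset.univ.image q ∉ H) : Hits H q ↔ Hits H (q ∘ Fin.succ) := by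
  constructor
  · rintro ⟨k, hk⟩
    cases k with
    | zero => exact absurd (suffix_zero q ▸ hk) h
    | succ k => exact ⟨k, suffix_succ q k ▸ hk⟩
  · rintro ⟨k, hk⟩
    exact ⟨k + 1, suffix_succ q k ▸ hk⟩

open Classical in
/-- `hitProb` is the probability that a uniformly random ordering meets `H`. -/
theorem card_hits_eq (H : Finset (Finset V)) : ∀ {m : ℕ} (g : Fin m → V),
    Function.Injective g →
    ((Finset.univ.filter fun σ : Equiv.Perm (Fin m) => Hits H (g ∘ σ)).card : ℝ)
      = m.factorial * hitProb H (Finset.univ.image g) := by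
  intro m
  induction m with
  | zero =>
    intro g _
    have hs : ∀ (q : Fin 0 → V) k, suffix q k = ∅ := fun q k => by
      ext x; simp [mem_suffix]
    by_cases h : (∅ : Finset V) ∈ H
    · simp [Hits, hs, h, hitProb_of_mem h]
    · have h0 : hitProb H ∅ = 0 := by rw [hitProb_of_notMem h]; simp
      simp [Hits, hs, h, h0]
  | succ m ih =>
    intro g hg
    have himg : ∀ σ : Equiv.Perm (Fin (m + 1)),
        Finset.univ.image (g ∘ σ) = Finset.univ.image g := fun σ => by
      rw [← Finset.image_image, Finset.image_univ_equiv]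
    by_cases hX : Finset.univ.image g ∈ H
    · have : ∀ σ : Equiv.Perm (Fin (m + 1)), Hits H (g ∘ σ) := fun σ =>
        ⟨0, by rw [suffix_zero, himg]; exact hX⟩
      simp [this, hitProb_of_mem hX, Fintype.card_perm]
    have hcard : (Finset.univ.image g).card = m + 1 := by
      rw [Finset.card_image_of_injective _ hg]; simp
    have hinj : ∀ p : Fin (m + 1), Function.Injective (g ∘ Equiv.swap 0 p ∘ Fin.succ) := fun p =>
      hg.comp ((Equiv.injective _).comp (Fin.succ_injective _))
    have htail : ∀ p : Fin (m + 1), Finset.univ.image (g ∘ Equiv.swap 0 p ∘ Fin.succ)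
        = (Finset.univ.image g).erase (g p) := by
      intro p
      refine Finset.eq_of_subset_of_card_le ?_ ?_
      · intro x hx
        obtain ⟨i, -, rfl⟩ := Finset.mem_image.1 hx
        refine Finset.mem_erase.2 ⟨fun e => ?_, by simp⟩
        have : Equiv.swap 0 p i.succ = p := hg e
        rw [Equiv.swap_apply_eq_iff, Equiv.swap_apply_right] at this
        exact Fin.succ_ne_zero _ this
      · rw [Finset.card_erase_of_mem (by simp), hcard,
          Finset.card_image_of_injective _ (hinj p)]
        simp
    -- Classify orderings by their first value g p; the rest is an arbitrary ordering of the
    -- remaining elements.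
    have hsplit : (Finset.univ.filter fun σ : Equiv.Perm (Fin (m + 1)) => Hits H (g ∘ σ)).card
        = ∑ p : Fin (m + 1), (Finset.univ.filter fun e : Equiv.Perm (Fin m) =>
            Hits H ((g ∘ Equiv.swap 0 p ∘ Fin.succ) ∘ e)).card := by
      simp only [Finset.card_filter]
      rw [← Fintype.sum_prod_type', ← Equiv.Perm.decomposeFin.symm.sum_comp]
      refine Finset.sum_congr rfl fun pe _ => ?_
      obtain ⟨p, e⟩ := pe
      rw [hits_of_notMem (by rw [himg]; exact hX)]
      congr 1
      have : (g ∘ (Equiv.Perm.decomposeFin.symm (p, e))) ∘ Fin.succ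
          = (g ∘ Equiv.swap 0 p ∘ Fin.succ) ∘ e := by
        funext i
        simp
      rw [this]
    rw [hsplit, Nat.cast_sum]
    simp only [fun p => ih _ (hinj p), htail]
    rw [hitProb_of_notMem hX, hcard, Finset.sum_image (fun a _ b _ h => hg h), Nat.factorial_succ,
      ← Finset.mul_sum]
    push_cast
    field_simp

end LubellBelow

/-! ### Pivots, and the mass of families with many nonpivots. -/

section Pivots

variable {V : Type*} [DecidableEq V]

/-- The elements `x` of `B` such that some member of `F` contains all of `B` but `x`. -/
def pivots (F : Finset (Finset V)) (B : Finset V) : Finset V :=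
  B.filter fun x => ∃ C ∈ F, B.erase x ⊆ C ∧ x ∉ C

/-- The elements of `B` that are not pivots. -/
def nonpivots (F : Finset (Finset V)) (B : Finset V) : Finset V :=
  B.filter fun x => ∀ C ∈ F, B.erase x ⊆ C → x ∈ C

theorem card_pivots_add_card_nonpivots (F : Finset (Finset V)) (B : Finset V) :
    (pivots F B).card + (nonpivots F B).card = B.card := by
  rw [← Finset.card_filter_add_card_filter_not (s := B)
    (fun x => ∃ C ∈ F, B.erase x ⊆ C ∧ x ∉ C), pivots, nonpivots]
  congr 2
  refine Finset.filter_congr fun x _ => ?_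
  push Not
  rfl

/-- Lets nonpivots found in the whole family be used in its subfamilies. -/
theorem nonpivots_anti {F G : Finset (Finset V)} (h : F ⊆ G) (B : Finset V) :
    nonpivots G B ⊆ nonpivots F B := fun x hx => by
  rw [nonpivots, Finset.mem_filter] at hx ⊢
  exact ⟨hx.1, fun C hC => hx.2 C (h hC)⟩

open Classical in
/-- If each member of `H` below the range of `q` has at least a quarter of that range as
nonpivots, then exchanging the first term of `q` with a random one yields a sequence that misses
`H` with probability at least a quarter. -/
theorem card_swap_hits_le {H : Finset (Finset V)} {m : ℕ} (q : Fin (m + 1) → V)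
    (hq : Function.Injective q) (htop : Finset.univ.image q ∉ H)
    (hH : ∀ C ∈ H, C ⊆ Finset.univ.image q → m + 1 ≤ 4 * (nonpivots H C).card) :
    4 * (Finset.univ.filter fun l : Fin (m + 1) => Hits H (q ∘ Equiv.swap 0 l)).card
      ≤ 3 * (m + 1) := by
  have hsub : ∀ l k, suffix (q ∘ Equiv.swap 0 l) k ⊆ Finset.univ.image q := by
    intro l k x hx
    obtain ⟨i, -, rfl⟩ := mem_suffix.1 hx
    simp
  have himg : ∀ l : Fin (m + 1), Finset.univ.image (q ∘ Equiv.swap 0 l)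
      = Finset.univ.image q := fun l => by
    rw [← Finset.image_image, Finset.image_univ_equiv]
  have hlt : ∀ l k, suffix (q ∘ Equiv.swap 0 l) k ∈ H → k ≤ m := by
    intro l k hk
    by_contra! hlt
    have hempty : suffix (q ∘ Equiv.swap 0 l) k = ∅ := by
      ext x
      simp only [mem_suffix, Finset.notMem_empty, iff_false]
      rintro ⟨i, hi, -⟩
      have := i.2
      omega
    have := hH _ hk (hsub l k)
    rw [hempty] at this
    simp [nonpivots] at this
  by_cases hne : ∃ k l, suffix (q ∘ Equiv.swap 0 l) k ∈ H
  swap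
  · push Not at hne
    have : (Finset.univ.filter fun l : Fin (m + 1) => Hits H (q ∘ Equiv.swap 0 l)) = ∅ :=
      Finset.filter_eq_empty_iff.2 fun l _ ⟨k, hk⟩ => hne k l hk
    simp [this]
  obtain ⟨k₀, l₀, h₀⟩ := hne
  -- Choose the latest suffix, hence the smallest set C, at which any of the swapped sequences meets
  -- `H`.
  obtain ⟨k, hkm, hk⟩ : ∃ k, (∃ l, suffix (q ∘ Equiv.swap 0 l) k ∈ H) ∧
      ∀ k', (∃ l, suffix (q ∘ Equiv.swap 0 l) k' ∈ H) → k' ≤ k :=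
    ⟨Nat.findGreatest (fun k => ∃ l, suffix (q ∘ Equiv.swap 0 l) k ∈ H) m,
      Nat.findGreatest_spec (P := fun k => ∃ l, suffix (q ∘ Equiv.swap 0 l) k ∈ H)
        (hlt l₀ k₀ h₀) ⟨l₀, h₀⟩,
      fun k' ⟨l', h'⟩ => Nat.le_findGreatest (hlt l' k' h') ⟨l', h'⟩⟩
  obtain ⟨l, hl⟩ := hkm
  set C := suffix (q ∘ Equiv.swap 0 l) k with hC
  have hk0 : k ≠ 0 := by
    rintro rfl
    rw [hC, suffix_zero, himg] at hl
    exact htop hl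
  -- Swapping q j to the front removes it from every proper suffix. A hit at k' ≤ k would be a
  -- member containing C \ {q j} but not q j, making q j a pivot of C.
  have hmiss : ∀ j, q j ∈ nonpivots H C → ¬ Hits H (q ∘ Equiv.swap 0 j) := by
    rintro j hj ⟨k', hk'⟩
    obtain ⟨hjC, hjn⟩ := Finset.mem_filter.1 hj
    have hle := hk k' ⟨j, hk'⟩
    have hk'0 : k' ≠ 0 := by
      rintro rfl
      rw [suffix_zero, himg] at hk'
      exact htop hk'
    have hj' : j = 0 ∨ k ≤ j := by
      obtain ⟨i, hi, hij⟩ := mem_suffix.1 hjC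
      have hij' : Equiv.swap 0 l i = j := hq hij
      rw [Equiv.swap_apply_def] at hij'
      split_ifs at hij' with h1 h2
      · subst h1; simp at hi; omega
      · exact Or.inl hij'.symm
      · exact Or.inr (hij' ▸ hi)
    have hmem := hjn _ hk' ?_
    · obtain ⟨i, hi, hij⟩ := mem_suffix.1 hmem
      have hij' : Equiv.swap 0 j i = j := hq hij
      rw [Equiv.swap_apply_eq_iff, Equiv.swap_apply_right] at hij'
      subst hij'
      simp at hi
      omega
    · intro x hx
      obtain ⟨hxj, hxC⟩ := Finset.mem_erase.1 hx
      obtain ⟨i, hi, rfl⟩ := mem_suffix.1 hxC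
      have hi0 : i ≠ 0 := by rintro rfl; simp at hi; omega
      refine mem_suffix.2 ⟨Equiv.swap 0 j (Equiv.swap 0 l i), ?_, by simp⟩
      have hne : Equiv.swap 0 l i ≠ j := fun e => hxj (by simp [e])
      rw [Equiv.swap_apply_def (x := Equiv.swap 0 l i), if_neg hne]
      split_ifs with h1
      · rcases hj' with rfl | hj'
        · exact absurd h1 hne
        · omega
      · rw [Equiv.swap_apply_def, if_neg hi0] at h1 ⊢
        split_ifs at h1 ⊢ with h2
        · exact absurd rfl h1
        · omega
  have hcard : (nonpivots H C).card
      ≤ (Finset.univ.filter fun j : Fin (m + 1) => ¬ Hits H (q ∘ Equiv.swap 0 j)).card := by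
    have himage : nonpivots H C ⊆ (Finset.univ.filter fun j : Fin (m + 1) =>
        ¬ Hits H (q ∘ Equiv.swap 0 j)).image q := by
      intro x hx
      obtain ⟨j, -, rfl⟩ := Finset.mem_image.1 (hsub l k (Finset.mem_filter.1 hx).1)
      exact Finset.mem_image_of_mem _ (by simpa using hmiss j hx)
    exact (Finset.card_le_card himage).trans Finset.card_image_le
  have htotal := Finset.card_filter_add_card_filter_not (s := Finset.univ)
    (fun j : Fin (m + 1) => Hits H (q ∘ Equiv.swap 0 j))
  rw [Finset.card_univ, Fintype.card_fin] at htotal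
  have := hH C hl (hsub l k)
  omega

/-- If `B` is not in `H` and each member of `H` below `B` has at least `|B| / 4` nonpivots, then a
random maximal chain of subsets of `B` misses `H` with probability at least a quarter. -/
theorem hitProb_le {H : Finset (Finset V)} {B : Finset V} (hB : B ∉ H)
    (hH : ∀ C ∈ H, C ⊆ B → B.card ≤ 4 * (nonpivots H C).card) : hitProb H B ≤ 3 / 4 := by
  classical
  rcases Nat.eq_zero_or_pos B.card with h0 | hpos
  · rw [hitProb_of_notMem hB, h0]
    norm_num
  obtain ⟨m, hm⟩ : ∃ m, B.card = m + 1 := ⟨B.card - 1, by omega⟩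
  let g : Fin (m + 1) → V := fun i => (B.equivFinOfCardEq hm).symm i
  have hg : Function.Injective g :=
    Subtype.val_injective.comp (B.equivFinOfCardEq hm).symm.injective
  have himg : Finset.univ.image g = B := by
    refine Finset.eq_of_subset_of_card_le ?_ ?_
    · intro x hx
      obtain ⟨i, -, rfl⟩ := Finset.mem_image.1 hx
      exact Subtype.property _
    · rw [Finset.card_image_of_injective _ hg, hm]; simp
  have himg' : ∀ σ : Equiv.Perm (Fin (m + 1)), Finset.univ.image (g ∘ σ) = B := fun σ => by
    rw [← Finset.image_image, Finset.image_univ_equiv, himg]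
  have hcount := card_hits_eq H g hg
  rw [himg] at hcount
  set P := (Finset.univ.filter fun σ : Equiv.Perm (Fin (m + 1)) => Hits H (g ∘ σ)).card with hP
  -- A fixed swap preserves the uniform distribution on orderings, so averaging over l and σ turns
  -- the bound for each ordering into one on `hitProb`.
  have hshift : ∀ l : Fin (m + 1), (Finset.univ.filter fun σ : Equiv.Perm (Fin (m + 1)) =>
      Hits H ((g ∘ σ) ∘ Equiv.swap 0 l)).card = P := by
    intro l
    refine Finset.card_equiv (Equiv.mulRight (Equiv.swap 0 l)) fun σ => ?_
    simp only [Finset.mem_filter, Finset.mem_univ, true_and]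
    rfl
  have hdouble := Finset.sum_card_bipartiteAbove_eq_sum_card_bipartiteBelow
    (s := (Finset.univ : Finset (Fin (m + 1))))
    (t := (Finset.univ : Finset (Equiv.Perm (Fin (m + 1)))))
    (fun l (σ : Equiv.Perm (Fin (m + 1))) => Hits H ((g ∘ σ) ∘ Equiv.swap 0 l))
  unfold Finset.bipartiteAbove Finset.bipartiteBelow at hdouble
  rw [Finset.sum_congr rfl fun l _ => hshift l] at hdouble
  have hbound : 4 * ((m + 1) * P) ≤ (m + 1).factorial * (3 * (m + 1)) := by
    have : (m + 1) * P = ∑ _l : Fin (m + 1), P := by simp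
    rw [this, hdouble, Finset.mul_sum]
    calc _ ≤ ∑ _σ : Equiv.Perm (Fin (m + 1)), 3 * (m + 1) :=
          Finset.sum_le_sum fun σ _ => card_swap_hits_le (g ∘ σ) (hg.comp σ.injective)
            (by rw [himg']; exact hB) (by rw [himg', ← hm]; exact hH)
      _ = _ := by simp [Fintype.card_perm]
  have hbound' : (4 : ℝ) * P ≤ 3 * (m + 1).factorial := by
    have : 4 * P ≤ 3 * (m + 1).factorial := by
      refine Nat.le_of_mul_le_mul_left (c := m + 1) ?_ (by omega)
      linarith
    exact_mod_cast this
  have hf : (0 : ℝ) < (m + 1).factorial := by positivity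
  rw [hcount] at hbound'
  nlinarith

/-- Large sets with many nonpivots have Lubell mass at most `4`. -/
theorem lubellBelow_le_four {H : Finset (Finset V)} {n : ℕ}
    (hle : ∀ B ∈ H, B.card ≤ n) (hH : ∀ B ∈ H, n ≤ 4 * (nonpivots H B).card) (X : Finset V) :
    lubellBelow H X ≤ 4 := by
  refine lubellBelow_le_of_forall_mem (by norm_num) ?_ X
  rcases H.eq_empty_or_nonempty with rfl | hne
  · simp
  obtain ⟨M, hM, hmax⟩ := Finset.exists_max_image H (lubellBelow H) hne
  -- M maximises the mass, so its own mass bounds what follows the first hit below M: μ ≤ 1 +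
  -- (3/4)μ, that is μ ≤ 4.
  have key : lubellBelow H M ≤ 1 + lubellBelow H M * (3 / 4) := by
    have h1 := lubellBelow_le_mul_hitProb (H := H.erase M) (c := lubellBelow H M)
      (fun B hB => (lubellBelow_mono (Finset.erase_subset _ _) B).trans
        (hmax B (Finset.mem_of_mem_erase hB))) M
    have h2 : hitProb (H.erase M) M ≤ 3 / 4 :=
      hitProb_le (Finset.notMem_erase _ _) fun C hC _ =>
        ((hle M hM).trans (hH C (Finset.mem_of_mem_erase hC))).trans
          (Nat.mul_le_mul_left 4 (Finset.card_le_card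
            (nonpivots_anti (Finset.erase_subset _ _) C)))
    have h3 := lubellBelow_of_mem hM
    have h4 := mul_le_mul_of_nonneg_left h2 (lubellBelow_nonneg H M)
    linarith
  intro B hB
  linarith [hmax B hB]

/-- Each set of size `s - 1` arises at most once from a member of size `s` by removing a
nonpivot. -/
theorem sum_card_nonpivots_le {H : Finset (Finset V)} {T : Finset V} {s : ℕ}
    (hT : ∀ B ∈ H, B ⊆ T) (hs : ∀ B ∈ H, B.card = s) :
    ∑ B ∈ H, (nonpivots H B).card ≤ T.card.choose (s - 1) := by
  rw [← Finset.card_sigma, ← Finset.card_powersetCard]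
  refine Finset.card_le_card_of_injOn (fun p => p.1.erase p.2) ?_ ?_
  · rintro ⟨B, x⟩ h
    obtain ⟨hB, hx⟩ := Finset.mem_sigma.1 h
    refine Finset.mem_powersetCard.2 ⟨(Finset.erase_subset _ _).trans (hT B hB), ?_⟩
    rw [Finset.card_erase_of_mem (Finset.mem_filter.1 hx).1, hs B hB]
  · rintro ⟨B, x⟩ h ⟨C, y⟩ h' e
    obtain ⟨hB, hx⟩ := Finset.mem_sigma.1 h
    obtain ⟨hC, hy⟩ := Finset.mem_sigma.1 h'
    obtain ⟨hxB, hx⟩ := Finset.mem_filter.1 hx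
    obtain ⟨hyC, hy⟩ := Finset.mem_filter.1 hy
    simp only at e hB hC hx hy hxB hyC
    -- C contains B \ {x} and x is a nonpivot, so x ∈ C; if x ≠ y then x would lie in C \ {y} = B \
    -- {x}.
    have hxC : x ∈ C := hx C hC (e ▸ Finset.erase_subset _ _)
    have hxy : x = y := by
      by_contra hne
      have : x ∈ B.erase x := e ▸ Finset.mem_erase.2 ⟨hne, hxC⟩
      simp at this
    subst hxy
    have : B = C := by rw [← Finset.insert_erase hxB, e, Finset.insert_erase hxC]
    subst this
    rfl

/-- Nonempty sets in the lower half with half of their elements nonpivots have Lubell mass at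
most `2`. -/
theorem lubellBelow_le_two {H : Finset (Finset V)} {T : Finset V}
    (hT : ∀ B ∈ H, B ⊆ T) (hne : ∀ B ∈ H, B.Nonempty)
    (hle : ∀ B ∈ H, 2 * B.card ≤ T.card)
    (hH : ∀ B ∈ H, B.card ≤ 2 * (nonpivots H B).card) : lubellBelow H T ≤ 2 := by
  set n := T.card with hn
  have hlayer : ∀ s ∈ Finset.Icc 1 (n / 2),
      ∑ B ∈ H with B.card = s, (1 : ℝ) / (n.choose B.card) ≤ 2 / (n - (n / 2 : ℕ) + 1) := by
    intro s hs
    obtain ⟨hs1, hs2⟩ := Finset.mem_Icc.1 hs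
    set K := H.filter fun B => B.card = s with hK
    have h1 := sum_card_nonpivots_le (H := K) (T := T) (s := s)
      (fun B hB => hT B (Finset.mem_filter.1 hB).1) (fun B hB => (Finset.mem_filter.1 hB).2)
    have h2 : K.card * s ≤ 2 * n.choose (s - 1) := by
      calc K.card * s = ∑ _B ∈ K, s := by simp
        _ ≤ ∑ B ∈ K, 2 * (nonpivots K B).card := Finset.sum_le_sum fun B hB => by
            obtain ⟨hB, hBs⟩ := Finset.mem_filter.1 hB
            have := hH B hB
            have hKH : K ⊆ H := Finset.filter_subset _ _
            have := Finset.card_le_card (nonpivots_anti hKH B)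
            omega
        _ ≤ _ := by rw [← Finset.mul_sum]; exact Nat.mul_le_mul_left 2 h1
    have h3 : n.choose s * s = n.choose (s - 1) * (n - (s - 1)) := by
      obtain ⟨r, rfl⟩ : ∃ r, s = r + 1 := ⟨s - 1, by omega⟩
      exact Nat.choose_succ_right_eq n r
    have hsum : ∑ B ∈ K, (1 : ℝ) / (n.choose B.card) = K.card / n.choose s := by
      rw [Finset.sum_congr rfl fun B hB => by rw [(Finset.mem_filter.1 hB).2],
        Finset.sum_const, nsmul_eq_mul, mul_one_div]
    have hpos : 0 < n.choose s := Nat.choose_pos (by omega)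
    have hhalf : ((n / 2 : ℕ) : ℝ) ≤ n := by exact_mod_cast Nat.div_le_self n 2
    rw [hsum, div_le_div_iff₀ (by exact_mod_cast hpos) (by linarith)]
    have h4 : K.card * (n - (s - 1)) ≤ 2 * n.choose s := by
      refine Nat.le_of_mul_le_mul_right (c := s) ?_ hs1
      calc K.card * (n - (s - 1)) * s = K.card * s * (n - (s - 1)) := by ring
        _ ≤ 2 * n.choose (s - 1) * (n - (s - 1)) := Nat.mul_le_mul_right _ h2
        _ = 2 * (n.choose s * s) := by rw [h3]; ring
        _ = _ := by ring
    have h5 : K.card * (n - n / 2 + 1) ≤ 2 * n.choose s :=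
      (Nat.mul_le_mul_left _ (by omega)).trans h4
    rw [← Nat.cast_sub (Nat.div_le_self n 2)]
    exact_mod_cast h5
  have hfib : lubellBelow H T = ∑ s ∈ Finset.Icc 1 (n / 2),
      ∑ B ∈ H with B.card = s, (1 : ℝ) / (n.choose B.card) := by
    rw [Finset.sum_fiberwise_of_maps_to, lubellBelow, Finset.filter_true_of_mem hT]
    intro B hB
    have := (hne B hB).card_pos
    have := hle B hB
    exact Finset.mem_Icc.2 ⟨by omega, by omega⟩
  have hhalf : (2 : ℝ) * (n / 2 : ℕ) ≤ n := by exact_mod_cast Nat.mul_div_le n 2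
  have hn0 : (0 : ℝ) ≤ n := by positivity
  rw [hfib]
  -- There are ⌊n/2⌋ layers, each of mass at most 2 / (n - ⌊n/2⌋ + 1).
  refine (Finset.sum_le_sum hlayer).trans ?_
  rw [Finset.sum_const, Nat.card_Icc, Nat.add_sub_cancel, nsmul_eq_mul, mul_div_assoc',
    div_le_iff₀ (by linarith)]
  linarith

end Pivots

/-! ### Beta weights, traces and Sauer–Shelah. -/

section Traces

variable {V : Type*} [DecidableEq V]

/-- The Beta integral `∫ x ^ t * (1 - x) ^ (m - t)` over the unit interval. -/
noncomputable def betaWeight (m t : ℕ) : ℝ := 1 / ((m + 1) * (m.choose t))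

/-- Under the integral this is x + (1 - x) = 1. -/
theorem betaWeight_add {m t : ℕ} (h : t ≤ m) :
    betaWeight (m + 1) t + betaWeight (m + 1) (t + 1) = betaWeight m t := by
  have h0 : (m.choose t : ℝ) ≠ 0 := by exact_mod_cast (Nat.choose_pos h).ne'
  have h1 : ((m + 1).choose t : ℝ) ≠ 0 := by exact_mod_cast (Nat.choose_pos (by omega)).ne'
  have h2 : ((m + 1).choose (t + 1) : ℝ) ≠ 0 := by
    exact_mod_cast (Nat.choose_pos (by omega)).ne'
  have e1 : (m.choose t : ℝ) * (m + 1) = (m + 1).choose t * (m + 1 - t) := by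
    have := Nat.choose_mul_succ_eq m t
    have h' : ((m + 1 - t : ℕ) : ℝ) = m + 1 - t := by
      rw [Nat.cast_sub (by omega)]; push_cast; ring
    rw [← h']
    exact_mod_cast this
  have e2 : ((m : ℝ) + 1) * m.choose t = (m + 1).choose (t + 1) * (t + 1) := by
    exact_mod_cast Nat.add_one_mul_choose_eq m t
  have h3 : ((m : ℝ) + 1) ≠ 0 := by positivity
  have i1 : 1 / ((m + 1).choose t : ℝ) = (m + 1 - t) / (m.choose t * (m + 1)) := by
    rw [div_eq_div_iff h1 (mul_ne_zero h0 h3)]; linarith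
  have i2 : 1 / ((m + 1).choose (t + 1) : ℝ) = (t + 1) / (m.choose t * (m + 1)) := by
    rw [div_eq_div_iff h2 (mul_ne_zero h0 h3)]; linarith
  have h4 : ((m : ℝ) + 1 + 1) ≠ 0 := by positivity
  unfold betaWeight
  push_cast
  rw [← one_div_mul_one_div, ← one_div_mul_one_div, i1, i2]
  field_simp
  ring

theorem betaWeight_nonneg (m t : ℕ) : 0 ≤ betaWeight m t := by
  unfold betaWeight; positivity

/-- Removing one element from all sets does not decrease the total Beta weight. -/
theorem sum_betaWeight_le_erase {F : Finset (Finset V)} {Y : Finset V} {y : V}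
    (hF : ∀ A ∈ F, A ⊆ insert y Y) :
    ∑ A ∈ F, betaWeight (Y.card + 1) A.card
      ≤ ∑ A ∈ F.image (fun A => A.erase y), betaWeight Y.card A.card := by
  rw [← Finset.sum_fiberwise_of_maps_to (t := F.image (fun A => A.erase y))
    (g := fun A => A.erase y) (fun A hA => Finset.mem_image_of_mem _ hA)]
  refine Finset.sum_le_sum fun τ hτ => ?_
  have hyτ : y ∉ τ := by
    obtain ⟨A, -, rfl⟩ := Finset.mem_image.1 hτ
    simp
  have hτY : τ ⊆ Y := by
    obtain ⟨A, hA, rfl⟩ := Finset.mem_image.1 hτ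
    intro x hx
    obtain ⟨h1, h2⟩ := Finset.mem_erase.1 hx
    exact (Finset.mem_insert.1 (hF A hA h2)).resolve_left h1
  -- A trace τ comes from at most τ and τ ∪ {y}, whose weights add up to that of τ.
  have hsub : F.filter (fun A => A.erase y = τ) ⊆ {τ, insert y τ} := by
    intro A hA
    obtain ⟨-, rfl⟩ := Finset.mem_filter.1 hA
    by_cases h : y ∈ A
    · simp [Finset.insert_erase h]
    · simp [Finset.erase_eq_of_notMem h]
  refine (Finset.sum_le_sum_of_subset_of_nonneg hsub
    fun _ _ _ => betaWeight_nonneg _ _).trans ?_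
  rw [Finset.sum_pair (fun e : τ = insert y τ => hyτ (e.symm ▸ Finset.mem_insert_self y τ)),
    Finset.card_insert_of_notMem hyτ, betaWeight_add (Finset.card_le_card hτY)]

/-- Passing to the traces on a subset does not decrease the total Beta weight. -/
theorem sum_betaWeight_le_trace {G W : Finset V} (hGW : Disjoint G W) :
    ∀ {F : Finset (Finset V)}, (∀ A ∈ F, A ⊆ G ∪ W) →
    ∑ A ∈ F, betaWeight (G ∪ W).card A.card
      ≤ ∑ A ∈ F.image (fun A => A ∩ G), betaWeight G.card A.card := by
  induction W using Finset.induction_on with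
  | empty =>
    intro F hF
    rw [Finset.union_empty] at hF ⊢
    refine le_of_eq ?_
    have himg : F.image (fun A => A ∩ G) = F :=
      (Finset.image_congr fun A hA => Finset.inter_eq_left.2 (hF A hA)).trans Finset.image_id
    rw [himg]
  | insert y W hyW ih =>
    intro F hF
    rw [Finset.disjoint_insert_right] at hGW
    have hy : y ∉ G ∪ W := by simp [hGW.1, hyW]
    rw [Finset.union_insert] at hF ⊢
    rw [Finset.card_insert_of_notMem hy]
    refine (sum_betaWeight_le_erase hF).trans ((ih hGW.2 ?_).trans (le_of_eq ?_))
    · intro A hA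
      obtain ⟨C, hC, rfl⟩ := Finset.mem_image.1 hA
      rw [← Finset.erase_insert hy]
      exact Finset.erase_subset_erase _ (hF C hC)
    · rw [Finset.image_image]
      congr 1
      refine Finset.image_congr fun A _ => ?_
      simp only [Function.comp, Finset.erase_inter]
      exact Finset.erase_eq_of_notMem fun h => hGW.1 (Finset.mem_inter.1 h).2

theorem sum_betaWeight_eq (F : Finset (Finset V)) (X : Finset V) :
    ∑ A ∈ F with A ⊆ X, betaWeight X.card A.card = lubellBelow F X / (X.card + 1) := by
  rw [lubellBelow, Finset.sum_div]
  refine Finset.sum_congr rfl fun A _ => ?_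
  rw [betaWeight, div_div, mul_comm]

theorem choose_two_le {g i : ℕ} (h1 : 2 ≤ i) (h2 : i + 2 ≤ g) : g.choose 2 ≤ g.choose i := by
  have key : ∀ j, 2 ≤ j → 2 * j ≤ g → g.choose 2 ≤ g.choose j := by
    intro j hj
    induction j, hj using Nat.le_induction with
    | base => exact fun _ => le_rfl
    | succ j _ ih =>
      intro h
      exact (ih (by omega)).trans (Nat.choose_le_succ_of_lt_half_left (by omega))
  rcases le_total (2 * i) g with h | h
  · exact key i h1 h
  · rw [← Nat.choose_symm (show i ≤ g by omega)]
    exact key (g - i) (by omega) (by omega)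

/-- A family with no shattered triple has Lubell mass at most `5`. -/
theorem lubellBelow_le_five {F : Finset (Finset V)} {G : Finset V} (hG : ∀ A ∈ F, A ⊆ G)
    (hsh : ∀ s, F.Shatters s → s.card ≤ 2) : lubellBelow F G ≤ 5 := by
  set g := G.card with hg
  have hcount : F.card ≤ 1 + g + g.choose 2 := by
    have hsub : F.shatterer ⊆ G.powersetCard 0 ∪ G.powersetCard 1 ∪ G.powersetCard 2 := by
      intro s hs
      have hs := Finset.mem_shatterer.1 hs
      obtain ⟨u, hu, hsu⟩ := hs (Finset.Subset.refl s)
      have hsG : s ⊆ G := (Finset.inter_eq_left.1 hsu).trans (hG u hu)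
      have hs2 := hsh s hs
      simp only [Finset.mem_union, Finset.mem_powersetCard, hsG, true_and]
      omega
    have h1 := (Finset.card_le_card_shatterer F).trans (Finset.card_le_card hsub)
    have h2 := Finset.card_union_le (G.powersetCard 0 ∪ G.powersetCard 1) (G.powersetCard 2)
    have h3 := Finset.card_union_le (G.powersetCard 0) (G.powersetCard 1)
    simp only [Finset.card_powersetCard, Nat.choose_zero_right, Nat.choose_one_right, ← hg] at h2 h3
    omega
  have hfilter : F.filter (· ⊆ G) = F := Finset.filter_true_of_mem hG
  have hlayer : ∀ i, (F.filter fun A => A.card = i).card ≤ g.choose i := by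
    intro i
    rw [hg, ← Finset.card_powersetCard]
    refine Finset.card_le_card fun A hA => ?_
    obtain ⟨hA, hi⟩ := Finset.mem_filter.1 hA
    exact Finset.mem_powersetCard.2 ⟨hG A hA, hi⟩
  have hmass : ∀ i, ∑ A ∈ F with A.card = i, (1 : ℝ) / (g.choose A.card)
      = (F.filter fun A => A.card = i).card / g.choose i := by
    intro i
    rw [Finset.sum_congr rfl fun A hA => by rw [(Finset.mem_filter.1 hA).2],
      Finset.sum_const, nsmul_eq_mul, mul_one_div]
  rcases Nat.lt_or_ge g 4 with hsmall | hbig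
  · have hfib : lubellBelow F G = ∑ i ∈ Finset.range (g + 1),
        ∑ A ∈ F with A.card = i, (1 : ℝ) / (g.choose A.card) := by
      rw [Finset.sum_fiberwise_of_maps_to, lubellBelow, hfilter]
      exact fun A hA => Finset.mem_range.2 (Nat.lt_succ_of_le (Finset.card_le_card (hG A hA)))
    rw [hfib]
    calc _ ≤ ∑ _i ∈ Finset.range (g + 1), (1 : ℝ) := by
          refine Finset.sum_le_sum fun i _ => ?_
          rw [hmass]
          exact div_le_one_of_le₀ (by exact_mod_cast hlayer i) (by positivity)
      _ = g + 1 := by simp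
      _ ≤ 5 := by
          have : (g : ℝ) < 4 := by exact_mod_cast hsmall
          linarith
  -- The four extreme layers have mass at most 4 and every other set weighs at most 1 / C(g, 2).
  -- With at most 1 + g + C(g, 2) sets in all, the worst case fills the extreme layers first.
  · set M := F.filter fun A => 2 ≤ A.card ∧ A.card + 2 ≤ g with hM
    have hsplit : ∀ φ : Finset V → ℝ, ∑ A ∈ F, φ A
        = (∑ A ∈ F with A.card = 0, φ A) + (∑ A ∈ F with A.card = g, φ A)
          + (∑ A ∈ F with A.card = 1, φ A) + (∑ A ∈ F with A.card = g - 1, φ A)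
          + ∑ A ∈ M, φ A := by
      intro φ
      simp only [hM, Finset.sum_filter, ← Finset.sum_add_distrib]
      refine Finset.sum_congr rfl fun A hA => ?_
      have := Finset.card_le_card (hG A hA)
      split_ifs <;> first | omega | simp
    have hcards := hsplit fun _ => 1
    simp only [Finset.sum_const, nsmul_eq_mul, mul_one] at hcards
    have hMsum : ∑ A ∈ M, (1 : ℝ) / (g.choose A.card) ≤ M.card / g.choose 2 := by
      rw [← mul_one_div, ← nsmul_eq_mul, ← Finset.sum_const]
      refine Finset.sum_le_sum fun A hA => ?_
      obtain ⟨-, h1, h2⟩ := Finset.mem_filter.1 hA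
      have h3 := choose_two_le h1 h2
      have h4 : 0 < g.choose 2 := Nat.choose_pos (by omega)
      gcongr
    rw [lubellBelow, hfilter, ← hg, hsplit]
    simp only [hmass]
    have a0 := hlayer 0
    have ag := hlayer g
    have a1 := hlayer 1
    have ag1 := hlayer (g - 1)
    have hsymm : g.choose (g - 1) = g := by
      rw [Nat.choose_symm (by omega), Nat.choose_one_right]
    rw [Nat.choose_zero_right] at a0
    rw [Nat.choose_self] at ag
    rw [Nat.choose_one_right] at a1
    rw [hsymm] at ag1
    rw [hsymm, Nat.choose_zero_right, Nat.choose_self, Nat.choose_one_right]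
    have hgc : g ≤ g.choose 2 := by
      rw [Nat.choose_two_right, Nat.le_div_iff_mul_le (by norm_num)]
      exact Nat.mul_le_mul_left _ (by omega)
    have hg0 : (0 : ℝ) < g := by exact_mod_cast (show 0 < g by omega)
    have hgc' : (g : ℝ) ≤ g.choose 2 := by exact_mod_cast hgc
    have hcount' : (F.card : ℝ) ≤ 1 + g + g.choose 2 := by exact_mod_cast hcount
    have b0 : ((F.filter fun A => A.card = 0).card : ℝ) ≤ 1 := by exact_mod_cast a0
    have bg : ((F.filter fun A => A.card = g).card : ℝ) ≤ 1 := by exact_mod_cast ag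
    have b1 : ((F.filter fun A => A.card = 1).card : ℝ) ≤ g := by exact_mod_cast a1
    have bg1 : ((F.filter fun A => A.card = g - 1).card : ℝ) ≤ g := by exact_mod_cast ag1
    set n0 := ((F.filter fun A => A.card = 0).card : ℝ)
    set ng := ((F.filter fun A => A.card = g).card : ℝ)
    set n1 := ((F.filter fun A => A.card = 1).card : ℝ)
    set ng1 := ((F.filter fun A => A.card = g - 1).card : ℝ)
    set c := (g.choose 2 : ℝ)
    have hc : 0 < c := by linarith
    have hMle : (M.card : ℝ) / c ≤ (1 + g + c - n0 - ng - n1 - ng1) / c := by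
      gcongr; linarith
    have hg4 : (4 : ℝ) ≤ g := by exact_mod_cast hbig
    have e1 : n1 / g - n1 / c ≤ 1 - g / c := by
      have : n1 / g - n1 / c = n1 * (1 / g - 1 / c) := by ring
      have h2 : 1 - (g : ℝ) / c = g * (1 / g - 1 / c) := by field_simp
      rw [this, h2]
      refine mul_le_mul_of_nonneg_right b1 (sub_nonneg.2 ?_)
      gcongr
    have e2 : ng1 / g - ng1 / c ≤ 1 - g / c := by
      have : ng1 / g - ng1 / c = ng1 * (1 / g - 1 / c) := by ring
      have h2 : 1 - (g : ℝ) / c = g * (1 / g - 1 / c) := by field_simp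
      rw [this, h2]
      refine mul_le_mul_of_nonneg_right bg1 (sub_nonneg.2 ?_)
      gcongr
    have hc1 : 1 / c ≤ 1 := by
      rw [div_le_one hc]; linarith
    have e3 : n0 - n0 / c ≤ 1 - 1 / c := by
      have : n0 - n0 / c = n0 * (1 - 1 / c) := by ring
      rw [this]
      nlinarith
    have e4 : ng - ng / c ≤ 1 - 1 / c := by
      have : ng - ng / c = ng * (1 - 1 / c) := by ring
      rw [this]
      nlinarith
    have e5 : (1 + g + c - n0 - ng - n1 - ng1) / c
        = 1 / c + g / c + 1 - n0 / c - ng / c - n1 / c - ng1 / c := by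
      field_simp
    have e6 : 0 ≤ 1 / c := by positivity
    have e7 : 0 ≤ g / c := by positivity
    push_cast
    simp only [div_one]
    linarith

end Traces

/-! ### The induced cube obtained from three pivots. -/

section Embedding

variable {V : Type*} [DecidableEq V]

/-- A triple of pivots of `B` shattered by the members below `B` gives an induced copy of the
three-dimensional Boolean lattice. -/
theorem nonempty_embedding_of_pivots {F : Finset (Finset V)} {T B : Finset V}
    (hT : ∀ A ∈ F, A ⊆ T) (hbot : ∅ ∈ F) (htop : T ∈ F) (hB : B ⊆ T)
    (x : Fin 3 → V) (hx : Function.Injective x)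
    (hpiv : ∀ i, x i ∈ pivots F B)
    (hlow : ∀ i, ∃ A ∈ F, A ⊆ B ∧ ∀ j, x j ∈ A ↔ j = i) :
    Nonempty (Finset (Fin 3) ↪o F) := by
  choose A hAF hAB hAx using hlow
  have hpiv' : ∀ i, ∃ C ∈ F, B.erase (x i) ⊆ C ∧ x i ∉ C := fun i =>
    (Finset.mem_filter.1 (hpiv i)).2
  have hxB : ∀ i, x i ∈ B := fun i => (Finset.mem_filter.1 (hpiv i)).1
  choose C hCF hCB hCx using hpiv'
  have hCx' : ∀ i j, x j ∈ C i ↔ j ≠ i := fun i j =>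
    ⟨fun h e => hCx i (e ▸ h), fun h => hCB i (Finset.mem_erase.2 ⟨hx.ne h, hxB j⟩)⟩
  have hAC : ∀ i j, i ≠ j → A i ⊆ C j := fun i j hij a ha =>
    hCB j (Finset.mem_erase.2 ⟨fun e => hij ((hAx i j).1 (e ▸ ha)).symm, hAB i ha⟩)
  -- Recording that Z has trace s on the triple makes order reflection automatic; preservation then
  -- rests on A i ⊆ C j for i ≠ j.
  have hex : ∀ s : Finset (Fin 3), ∃ Z ∈ F, (∀ j, x j ∈ Z ↔ j ∈ s) ∧
      ((s = ∅ ∧ Z = ∅) ∨ (∃ i, s = {i} ∧ Z = A i) ∨ (∃ i, s = {i}ᶜ ∧ Z = C i) ∨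
        (s = Finset.univ ∧ Z = T)) := by
    intro s
    have hs : s = ∅ ∨ (∃ i, s = {i}) ∨ (∃ i, s = {i}ᶜ) ∨ s = Finset.univ := by
      revert s; decide
    rcases hs with rfl | ⟨i, rfl⟩ | ⟨i, rfl⟩ | rfl
    · exact ⟨∅, hbot, by simp, Or.inl ⟨rfl, rfl⟩⟩
    · exact ⟨A i, hAF i, by simp [hAx], Or.inr (Or.inl ⟨i, rfl, rfl⟩)⟩
    · exact ⟨C i, hCF i, by simp [hCx'], Or.inr (Or.inr (Or.inl ⟨i, rfl, rfl⟩))⟩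
    · exact ⟨T, htop, fun j => by simp [hB (hxB j)], Or.inr (Or.inr (Or.inr ⟨rfl, rfl⟩))⟩
  choose f hfF hfx hf using hex
  refine ⟨OrderEmbedding.ofMapLEIff (fun s => ⟨f s, hfF s⟩) fun s t => ?_⟩
  change f s ⊆ f t ↔ s ⊆ t
  refine ⟨fun h j hj => (hfx t j).1 (h ((hfx s j).2 hj)), fun h => ?_⟩
  rcases eq_or_ne s t with rfl | hne
  · exact subset_rfl
  rcases hf t with ⟨rfl, -⟩ | ⟨j, rfl, ht⟩ | ⟨j, rfl, ht⟩ | ⟨rfl, ht⟩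
  · exact absurd (Finset.subset_empty.1 h) hne
  · rcases Finset.subset_singleton_iff.1 h with rfl | rfl
    · rcases hf ∅ with ⟨-, hs⟩ | ⟨i, hi, -⟩ | ⟨i, hi, -⟩ | ⟨hi, -⟩
      · simp [hs]
      · exact absurd hi (by revert i; decide)
      · exact absurd hi (by revert i; decide)
      · exact absurd hi (by decide)
    · exact absurd rfl hne
  · rcases hf s with ⟨-, hs⟩ | ⟨i, rfl, hs⟩ | ⟨i, rfl, -⟩ | ⟨rfl, -⟩
    · simp [hs]
    · rw [hs, ht]
      exact hAC i j (by simpa [eq_comm] using h)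
    · have : j = i := by simpa using h
      exact absurd (by rw [this]) hne
    · exact absurd (h (Finset.mem_univ j)) (by simp)
  · rw [ht]
    exact hT _ (hfF s)

/-- Pivots are rare below sets that see a large Lubell mass. -/
theorem lubellBelow_le_of_pivots {F : Finset (Finset V)} {T B : Finset V}
    (hT : ∀ A ∈ F, A ⊆ T) (hbot : ∅ ∈ F) (htop : T ∈ F) (hB : B ⊆ T)
    (hfree : IsEmpty (Finset (Fin 3) ↪o F)) :
    lubellBelow F B * ((pivots F B).card + 1) ≤ 5 * (B.card + 1) := by
  set G := pivots F B with hG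
  have hGB : G ⊆ B := Finset.filter_subset _ _
  set F' := (F.filter (· ⊆ B)).image fun A => A ∩ G with hF'
  have hsub : ∀ A ∈ F', A ⊆ G := by
    intro A hA
    obtain ⟨A, -, rfl⟩ := Finset.mem_image.1 hA
    exact Finset.inter_subset_right
  have hsh : ∀ s, F'.Shatters s → s.card ≤ 2 := by
    intro s hs
    by_contra! hcard
    obtain ⟨s', hs's, hs'3⟩ := Finset.exists_subset_card_eq hcard
    have hs' := hs.mono_right hs's
    have hs'G : s' ⊆ G := by
      obtain ⟨u, hu, hsu⟩ := hs' (Finset.Subset.refl s')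
      exact (Finset.inter_eq_left.1 hsu).trans (hsub u hu)
    let x : Fin 3 → V := fun i => (s'.equivFinOfCardEq hs'3).symm i
    have hx : Function.Injective x :=
      Subtype.val_injective.comp (s'.equivFinOfCardEq hs'3).symm.injective
    have hxs : ∀ i, x i ∈ s' := fun i => Subtype.property _
    obtain ⟨e⟩ := nonempty_embedding_of_pivots hT hbot htop hB x hx (fun i => hs'G (hxs i)) (by
      intro i
      obtain ⟨u, hu, hsu⟩ := hs' (Finset.singleton_subset_iff.2 (hxs i))
      obtain ⟨A, hA, rfl⟩ := Finset.mem_image.1 hu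
      obtain ⟨hAF, hAB⟩ := Finset.mem_filter.1 hA
      refine ⟨A, hAF, hAB, fun j => ?_⟩
      have : x j ∈ s' ∩ (A ∩ G) ↔ x j ∈ A := by simp [hxs j, hs'G (hxs j)]
      rw [← this, hsu, Finset.mem_singleton, hx.eq_iff])
    exact hfree.elim e
  have h1 := sum_betaWeight_le_trace (G := G) (W := B \ G) Finset.disjoint_sdiff
    (F := F.filter (· ⊆ B)) (fun A hA => by
      rw [Finset.union_sdiff_of_subset hGB]; exact (Finset.mem_filter.1 hA).2)
  have h2 := sum_betaWeight_eq F' G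
  rw [Finset.filter_true_of_mem hsub] at h2
  rw [Finset.union_sdiff_of_subset hGB, sum_betaWeight_eq, ← hF', h2,
    div_le_div_iff₀ (by positivity) (by positivity)] at h1
  refine h1.trans ?_
  gcongr
  exact lubellBelow_le_five hsub hsh

end Embedding

/-! ### Assembling the bound 10 + 2 + 4. -/

section Threshold

variable {V : Type*} [DecidableEq V]

theorem lubellBelow_le_sixteen_of_bot_top {F : Finset (Finset V)} {T : Finset V}
    (hT : ∀ A ∈ F, A ⊆ T) (hbot : ∅ ∈ F) (htop : T ∈ F)
    (hfree : IsEmpty (Finset (Fin 3) ↪o F)) : lubellBelow F T ≤ 16 := by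
  classical
  set L := F.filter fun B => lubellBelow F B ≤ 10 with hL
  set H := F.filter fun B => ¬ lubellBelow F B ≤ 10 with hH
  set H₁ := H.filter fun B => 2 * B.card ≤ T.card with hH₁
  set H₂ := H.filter fun B => ¬ 2 * B.card ≤ T.card with hH₂
  have hHF : H ⊆ F := Finset.filter_subset _ _
  have hunion : F = L ∪ (H₁ ∪ H₂) := by
    rw [hH₁, hH₂, Finset.filter_union_filter_not_eq, hL, hH, Finset.filter_union_filter_not_eq]
  have hnon : ∀ B ∈ H, B.card < 2 * (nonpivots F B).card := by
    intro B hB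
    obtain ⟨hBF, hB10⟩ := Finset.mem_filter.1 hB
    have h1 := lubellBelow_le_of_pivots hT hbot htop (hT B hBF) hfree
    have h2 := card_pivots_add_card_nonpivots F B
    push Not at hB10
    have h3 : (10 : ℝ) * ((pivots F B).card + 1) < 5 * (B.card + 1) :=
      (mul_lt_mul_of_pos_right hB10 (Nat.cast_add_one_pos _)).trans_le h1
    have h4 : 10 * ((pivots F B).card + 1) < 5 * (B.card + 1) := by exact_mod_cast h3
    omega
  have hL10 : lubellBelow L T ≤ 10 :=
    lubellBelow_le_of_forall_mem (by norm_num) (fun B hB =>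
      (lubellBelow_mono (Finset.filter_subset _ _) B).trans (Finset.mem_filter.1 hB).2) T
  have hsub₁ : H₁ ⊆ H := Finset.filter_subset _ _
  have hsub₂ : H₂ ⊆ H := Finset.filter_subset _ _
  have hnon₁ : ∀ B ∈ H₁, B.card < 2 * (nonpivots H₁ B).card := fun B hB =>
    (hnon B (hsub₁ hB)).trans_le (Nat.mul_le_mul_left 2
      (Finset.card_le_card (nonpivots_anti (hsub₁.trans hHF) B)))
  have hnon₂ : ∀ B ∈ H₂, B.card < 2 * (nonpivots H₂ B).card := fun B hB =>
    (hnon B (hsub₂ hB)).trans_le (Nat.mul_le_mul_left 2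
      (Finset.card_le_card (nonpivots_anti (hsub₂.trans hHF) B)))
  have hlow : lubellBelow H₁ T ≤ 2 := by
    refine lubellBelow_le_two (fun B hB => hT B (hHF (hsub₁ hB))) (fun B hB => ?_)
      (fun B hB => (Finset.mem_filter.1 hB).2) fun B hB => (hnon₁ B hB).le
    -- The empty set has no nonpivots, so the strict inequality in `hnon₁` excludes it.
    rw [Finset.nonempty_iff_ne_empty]
    rintro rfl
    have := hnon₁ ∅ hB
    simp [nonpivots] at this
  have hhigh : lubellBelow H₂ T ≤ 4 := by
    refine lubellBelow_le_four (n := T.card)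
      (fun B hB => Finset.card_le_card (hT B (hHF (hsub₂ hB)))) (fun B hB => ?_) T
    have h1 := hnon₂ B hB
    have h2 := (Finset.mem_filter.1 hB).2
    omega
  have h1 := lubellBelow_union_le L (H₁ ∪ H₂) T
  have h2 := lubellBelow_union_le H₁ H₂ T
  rw [← hunion] at h1
  linarith

/-- Conditioning on the largest member of the chain supplies the top element T. -/
theorem lubellBelow_le_sixteen_of_bot {F : Finset (Finset V)} (hbot : ∅ ∈ F)
    (hfree : IsEmpty (Finset (Fin 3) ↪o F)) (X : Finset V) : lubellBelow F X ≤ 16 := by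
  refine lubellBelow_le_of_forall_mem (by norm_num) (fun T hT => ?_) X
  have h : lubellBelow (F.filter (· ⊆ T)) T = lubellBelow F T := by
    simp [lubellBelow, Finset.filter_filter]
  rw [← h]
  refine lubellBelow_le_sixteen_of_bot_top (fun A hA => (Finset.mem_filter.1 hA).2)
    (by simp [hbot]) (by simp [hT]) ⟨fun e => hfree.elim (e.trans ?_)⟩
  exact ⟨⟨fun A => ⟨A.1, (Finset.mem_filter.1 A.2).1⟩, fun A B h =>
    Subtype.ext (congrArg (fun Z : F => (Z : Finset V)) h)⟩, Iff.rfl⟩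

/-- Complementation inside `X` preserves the Lubell mass below `X`. -/
theorem lubellBelow_image_sdiff (F : Finset (Finset V)) (X : Finset V) :
    lubellBelow ((F.filter (· ⊆ X)).image fun A => X \ A) X = lubellBelow F X := by
  have hsub : ∀ A ∈ (F.filter (· ⊆ X)).image (fun A => X \ A), A ⊆ X := by
    intro A hA
    obtain ⟨A, -, rfl⟩ := Finset.mem_image.1 hA
    exact Finset.sdiff_subset
  rw [lubellBelow, Finset.filter_true_of_mem hsub, Finset.sum_image, lubellBelow]
  · refine Finset.sum_congr rfl fun A hA => ?_
    have hAX := (Finset.mem_filter.1 hA).2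
    rw [Finset.card_sdiff_of_subset hAX, Nat.choose_symm (Finset.card_le_card hAX)]
  · intro A hA B hB h
    have hAX := (Finset.mem_filter.1 hA).2
    have hBX := (Finset.mem_filter.1 hB).2
    rw [← Finset.sdiff_sdiff_eq_self hAX, ← Finset.sdiff_sdiff_eq_self hBX]
    exact congrArg (X \ ·) h

/-- A family with no induced three-dimensional Boolean lattice has Lubell mass at most `16`. -/
theorem lubellBelow_le_sixteen {F : Finset (Finset V)}
    (hfree : IsEmpty (Finset (Fin 3) ↪o F)) (X : Finset V) : lubellBelow F X ≤ 16 := by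
  rw [← lubellBelow_image_sdiff]
  set K := (F.filter (· ⊆ X)).image fun A => X \ A with hK
  refine lubellBelow_le_of_forall_mem (by norm_num) (fun Y hY => ?_) X
  rw [← lubellBelow_image_sdiff]
  -- Complementing twice, `J` is the part of F between the member X \ Y and X, with X \ Y removed
  -- from each set; it contains ∅ and inherits cube-freeness.
  set J := (K.filter (· ⊆ Y)).image fun A => Y \ A with hJ
  have hYX : Y ⊆ X := by
    obtain ⟨A, -, rfl⟩ := Finset.mem_image.1 hY
    exact Finset.sdiff_subset
  have hmem : ∀ A ∈ J, A ⊆ Y ∧ A ∪ (X \ Y) ∈ F := by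
    intro A hA
    obtain ⟨C, hC, rfl⟩ := Finset.mem_image.1 hA
    obtain ⟨hCK, hCY⟩ := Finset.mem_filter.1 hC
    obtain ⟨D, hD, rfl⟩ := Finset.mem_image.1 hCK
    obtain ⟨hDF, hDX⟩ := Finset.mem_filter.1 hD
    refine ⟨Finset.sdiff_subset, ?_⟩
    have : Y \ (X \ D) ∪ X \ Y = D := by
      ext v
      have h1 := @hCY v
      have h2 := @hDX v
      have h3 := @hYX v
      simp only [Finset.mem_union, Finset.mem_sdiff] at h1 ⊢
      tauto
    rwa [this]
  refine lubellBelow_le_sixteen_of_bot (F := J) ?_ ⟨fun e => hfree.elim (e.trans ?_)⟩ Y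
  · exact Finset.mem_image.2 ⟨Y, by simp [hY], by simp⟩
  · refine OrderEmbedding.ofMapLEIff (fun A => ⟨A.1 ∪ (X \ Y), (hmem A.1 A.2).2⟩) fun A B => ?_
    change A.1 ∪ (X \ Y) ⊆ B.1 ∪ (X \ Y) ↔ A.1 ⊆ B.1
    refine ⟨fun h v hv => ?_, fun h => Finset.union_subset_union_left h⟩
    have hvY := (hmem A.1 A.2).1 hv
    have := h (Finset.mem_union_left _ hv)
    simpa [hvY] using this

end Threshold

theorem mainTheorem8 : strongLubellThreshold (BooleanLattice 3) ≤ 16 := by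
  refine iSup_le fun n => iSup_le fun F => iSup_le fun hF => ?_
  have h := lubellBelow_le_sixteen (F := F) hF Finset.univ
  have heq : lubell F = lubellBelow F Finset.univ := by
    rw [lubell_eq_sum, lubellBelow]
    simp
  rw [heq]
  exact (EReal.coe_le_coe_iff.2 h).trans_eq rfl
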